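/- Let $A$ be a regular local ring of dimension $r$ with maximal ideal $\mathfrak m$. For an $A$-module $M$ and $i \ge 0$ put $H^i(M) = H^i_{\mathfrak m}(M) = \varinjlim_k \operatorname{Ext}^i_A(A/\mathfrak m^k, M)$, and let $D = \operatorname{Hom}_A(-, H^r(A))$. For $0 \le i \le r$ let $$\varphi : H^i(M) \longrightarrow D\bigl(\operatorname{Ext}^{r-i}_A(M, A)\bigr)$$ be the direct limit over $k$ of the homomorphisms $$\operatorname{Ext}^i_A(A/\mathfrak m^k, M) \to \operatorname{Hom}_A\bigl(\operatorname{Ext}^{r-i}_A(M, A), \operatorname{Ext}^r_A(A/\mathfrak m^k, A)\bigr), \qquad \alpha \mapsto (\beta \mapsto \beta \circ \alpha),$$ given by the Yoneda product; for $i > r$ put $\operatorname{Ext}^{r-i}_A(M,A) = 0$ and $\varphi = 0$. Then $\varphi$ is a homomorphism of $\delta$-functors in $M$: it is natural in $M$, and for every short exact sequence $0 \to M' \to M \to M'' \to 0$ it commutes with the connecting homomorphisms $H^i(M'') \to H^{i+1}(M')$ and $D(\operatorname{Ext}^{r-i}_A(M'',A)) \to D(\operatorname{Ext}^{r-i-1}_A(M',A))$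 (those of $\operatorname{Ext}$ being the Yoneda products with the class of the sequence in $\operatorname{Ext}^1_A(M'', M')$). For every finitely generated $A$-module $M$ and every $i \ge 0$, $$\varphi : H^i(M) \to D\bigl(\operatorname{Ext}^{r-i}_A(M, A)\bigr)$$ is an isomorphism; in particular $H^i(M) = 0$ for $i > r$. -/

import Mathlib

open CategoryTheory CategoryTheory.Abelian

universe u

noncomputable section

namespace LocalDuality

variable {A : Type u} [CommRing A]

/-- The cyclic module `A / J ^ k`, as an object of the category of `A`-modules. -/
abbrev quotPow (J : Ideal A) (k : ℕ) : ModuleCat.{u} A :=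
  ModuleCat.of A (A ⧸ J ^ k)

/-- The canonical surjection `A / J ^ l → A / J ^ k` for `k ≤ l`. -/
def quotPowMap (J : Ideal A) {k l : ℕ} (h : k ≤ l) : quotPow J l ⟶ quotPow J k :=
  ModuleCat.ofHom (Submodule.factor (Ideal.pow_le_pow_right h))

/-- The transition map `Ext^i(A / J ^ k, M) → Ext^i(A / J ^ l, M)` for `k ≤ l`, which is induced
by the canonical surjection `A / J ^ l → A / J ^ k`. -/
def extTransition (J : Ideal A) (M : ModuleCat.{u} A) (i : ℕ) (k l : ℕ) (h : k ≤ l) :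
    Ext (quotPow J k) M i →ₗ[A] Ext (quotPow J l) M i :=
  (Ext.mk₀ (quotPowMap J h)).precompOfLinear A M (zero_add i)

instance (J : Ideal A) (M : ModuleCat.{u} A) (i : ℕ) :
    DirectedSystem (fun k ↦ Ext (quotPow J k) M i)
      (fun k l h ↦ extTransition J M i k l h) where
  map_self k x := by
    have : quotPowMap J (le_refl k) = 𝟙 _ := by
      ext
      rfl
    simp [extTransition, this]
  map_map k l n h₁ h₂ x := by
    have : quotPowMap J (h₁.trans h₂) = quotPowMap J h₂ ≫ quotPowMap J h₁ := by
      ext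
      rfl
    simp [extTransition, this]

/-- The local cohomology module `H^i_J(M) = colim_k Ext^i(A / J ^ k, M)` of `M` with support in
the ideal `J`. This is the direct limit by which Mathlib's functor `localCohomology` is defined;
here the groups `Ext^i` are those of the derived category, for which there are Yoneda products
and connecting homomorphisms. -/
abbrev LocalCohomology (J : Ideal A) (M : ModuleCat.{u} A) (i : ℕ) : Type u :=
  Module.DirectLimit (fun k ↦ Ext (quotPow J k) M i) (extTransition J M i)

/-- The canonical map `Ext^i(A / J ^ k, M) → H^i_J(M)`. -/
def toLocalCohomology (J : Ideal A) (M : ModuleCat.{u} A) (i k : ℕ) :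
    Ext (quotPow J k) M i →ₗ[A] LocalCohomology J M i :=
  Module.DirectLimit.of A ℕ (fun k ↦ Ext (quotPow J k) M i) (extTransition J M i) k

/-- The map `H^a_J(M) → H^b_J(P)`, where `a + n = b`, which is the direct limit over `k` of the
Yoneda products `Ext^a(A / J ^ k, M) → Ext^b(A / J ^ k, P)`, `α ↦ β ∘ α`, with a fixed element
`β` of `Ext^n(M, P)`. -/
def yonedaAction (J : Ideal A) {M P : ModuleCat.{u} A} {n : ℕ} (β : Ext M P n) {a b : ℕ}
    (h : a + n = b) : LocalCohomology J M a →ₗ[A] LocalCohomology J P b :=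
  Module.DirectLimit.map (fun k ↦ β.postcompOfLinear A (quotPow J k) h) (by
    intro k l hkl
    ext α
    simp only [extTransition, LinearMap.comp_apply, LinearMap.flip_apply,
      Ext.bilinearCompOfLinear_apply_apply]
    exact Ext.comp_assoc _ _ _ _ _ (by omega))

lemma yonedaAction_toLocalCohomology (J : Ideal A) {M P : ModuleCat.{u} A} {n : ℕ}
    (β : Ext M P n) {a b : ℕ} (h : a + n = b) (k : ℕ) (α : Ext (quotPow J k) M a) :
    yonedaAction J β h (toLocalCohomology J M a k α) =
      toLocalCohomology J P b k (α.comp β h) :=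
  Module.DirectLimit.map_apply_of _ _ _

/-- The map `H^i_J(M) → H^i_J(M')` induced by a homomorphism `f : M → M'`. -/
def LocalCohomology.map (J : Ideal A) {M M' : ModuleCat.{u} A} (f : M ⟶ M') (i : ℕ) :
    LocalCohomology J M i →ₗ[A] LocalCohomology J M' i :=
  yonedaAction J (Ext.mk₀ f) (add_zero i)

/-- The connecting homomorphism `H^i_J(M'') → H^{i+1}_J(M')` of a short exact sequence
`0 → M' → M → M'' → 0`: the direct limit of the connecting homomorphisms
`Ext^i(A / J ^ k, M'') → Ext^{i+1}(A / J ^ k, M')`. -/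
def LocalCohomology.δ (J : Ideal A) {S : ShortComplex (ModuleCat.{u} A)} (hS : S.ShortExact)
    (i : ℕ) : LocalCohomology J S.X₃ i →ₗ[A] LocalCohomology J S.X₁ (i + 1) :=
  yonedaAction J hS.extClass rfl

/-- The map `Ext^j(M', P) → Ext^j(M, P)` induced by a homomorphism `f : M → M'`. -/
def extMap {M M' : ModuleCat.{u} A} (f : M ⟶ M') (P : ModuleCat.{u} A) (j : ℕ) :
    Ext M' P j →ₗ[A] Ext M P j :=
  (Ext.mk₀ f).precompOfLinear A P (zero_add j)

/-- The connecting homomorphism `Ext^j(M', P) → Ext^{j+1}(M'', P)` of a short exact sequence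
`0 → M' → M → M'' → 0`. -/
def extδ {S : ShortComplex (ModuleCat.{u} A)} (hS : S.ShortExact) (P : ModuleCat.{u} A) (j : ℕ) :
    Ext S.X₁ P j →ₗ[A] Ext S.X₃ P (j + 1) :=
  hS.extClass.precompOfLinear A P (add_comm 1 j)

section Duality

variable (A) [IsLocalRing A] (r : ℕ)

/-- The module `I = H^r_m(A)`, where `m` is the maximal ideal of the local ring `A`. -/
abbrev DualizingModule : Type u :=
  LocalCohomology (IsLocalRing.maximalIdeal A) (ModuleCat.of A A) r

/-- The functor `D = Hom_A(-, I)` with `I = H^r_m(A)`, on objects. -/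
abbrev D (X : Type u) [AddCommGroup X] [Module A X] : Type u :=
  X →ₗ[A] DualizingModule A r

/-- The contravariant functor `D = Hom_A(-, I)`, on homomorphisms. -/
def D.map {X Y : Type u} [AddCommGroup X] [Module A X] [AddCommGroup Y] [Module A Y]
    (f : X →ₗ[A] Y) : D A r Y →ₗ[A] D A r X :=
  LinearMap.lcomp A (DualizingModule A r) f

variable {A r}

/-- The duality homomorphism `φ : H^i_m(M) → D(Ext^j(M, A))`, where `i + j = r`: the direct limit
over `k` of the maps `Ext^i(A / m ^ k, M) → Hom_A(Ext^j(M, A), Ext^r(A / m ^ k, A))` given by the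
Yoneda product `α ↦ (β ↦ β ∘ α)`. -/
def φ (M : ModuleCat.{u} A) (i j : ℕ) (h : i + j = r) :
    LocalCohomology (IsLocalRing.maximalIdeal A) M i →ₗ[A]
      D A r (Ext M (ModuleCat.of A A) j) :=
  Module.DirectLimit.lift A ℕ _ _
    (fun k ↦
      (toLocalCohomology (IsLocalRing.maximalIdeal A) (ModuleCat.of A A) r k).compRight A ∘ₗ
        Ext.bilinearCompOfLinear A (quotPow (IsLocalRing.maximalIdeal A) k) M
          (ModuleCat.of A A) i j r h)
    (by
      intro k l hkl α
      ext β
      have e : ((Ext.mk₀ (quotPowMap (IsLocalRing.maximalIdeal A) hkl)).comp α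
          (zero_add i)).comp β h =
          extTransition (IsLocalRing.maximalIdeal A) (ModuleCat.of A A) r k l hkl
            (α.comp β h) := Ext.comp_assoc _ _ _ _ _ (by omega)
      change toLocalCohomology _ _ r l _ = toLocalCohomology _ _ r k (α.comp β h)
      exact (congrArg _ e).trans Module.DirectLimit.of_f)

lemma φ_toLocalCohomology (M : ModuleCat.{u} A) (i j : ℕ) (h : i + j = r) (k : ℕ)
    (α : Ext (quotPow (IsLocalRing.maximalIdeal A) k) M i) (β : Ext M (ModuleCat.of A A) j) :
    φ M i j h (toLocalCohomology _ M i k α) β =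
      toLocalCohomology _ (ModuleCat.of A A) r k (α.comp β h) := by
  simp only [φ, toLocalCohomology, Module.DirectLimit.lift_of]
  rfl

end Duality

end LocalDuality

end

/-! Two facts carry the proof: `H^r(A)` is injective, so that `D` is exact, and `φ` is bijective for
`M = A`. For `A` itself `φ` is essentially the identity of `H^r(A)` in degree `r`, and both sides
vanish in the other degrees; finite free modules follow by additivity. Now take `0 → K → F → M → 0`
with `F` finite free. Since `H^{r+1}(K) = 0`, both `H^r` and `D(Ext^0(-, A))` are right exact, and a
diagram chase settles `i = r` (`φ_bijective_top`). Lower degrees follow by shifting along the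
connecting maps, because both sides vanish for `F` when `i < r` (`φ_bijective`).

For injectivity, let `N` be finitely generated and killed by a power of `m`. As `m` is generated by
a regular sequence of length `r`, `Ext^i(N, A) = 0` for `i ≠ r`, so `Ext^r(-, A)` is exact on such
modules. A class `β` in `Ext^r(N, A)` gives a map `N → H^r(A)`: send `n` to the class of `β ∘ g`,
where `g : A / m^k → N` takes `1` to `n`. Dévissage to the residue field shows that every map arises
from exactly one `β`. Thus `Hom(-, H^r(A))` is exact on these modules, and Baer's criterion with
Artin–Rees extends this to all modules. -/

/-! ### Regular local rings: regular parameters -/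

open IsLocalRing in
/-- An element of `m \ m ^ 2` is part of a minimal system of generators of `m`. -/
lemma IsLocalRing.exists_span_insert_eq_maximalIdeal {A : Type*} [CommRing A] [IsLocalRing A]
    [IsNoetherianRing A] {n : ℕ} (hn : (maximalIdeal A).spanFinrank = n + 1) {x : A}
    (hx : x ∈ maximalIdeal A) (hx2 : x ∉ maximalIdeal A ^ 2) :
    ∃ s : Finset A, s.card = n ∧ Ideal.span (insert x (s : Set A)) = maximalIdeal A := by
  classical
  obtain ⟨t, ht, hspan⟩ :=
    Submodule.FG.exists_span_finset_card_eq_spanFinrank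
      (maximalIdeal A).fg_of_isNoetherianRing
  change Ideal.span (t : Set A) = _ at hspan
  have hxt : x ∈ Ideal.span (t : Set A) := hspan ▸ hx
  obtain ⟨c, -, hc⟩ := Submodule.mem_span_finset.mp hxt
  obtain ⟨a, hat, ha⟩ : ∃ a ∈ t, IsUnit (c a) := by
    by_contra! h
    refine hx2 (hc ▸ Ideal.sum_mem _ fun a hat ↦ ?_)
    rw [smul_eq_mul, pow_two]
    exact Ideal.mul_mem_mul ((mem_maximalIdeal _).mpr (h a hat))
      (hspan ▸ Ideal.subset_span hat)
  refine ⟨t.erase a, by rw [Finset.card_erase_of_mem hat, ht, hn]; rfl, le_antisymm ?_ ?_⟩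
  · refine Ideal.span_le.mpr (Set.insert_subset hx fun b hb ↦ ?_)
    exact hspan ▸ Ideal.subset_span (Finset.mem_of_mem_erase hb)
  · rw [← hspan]
    refine Ideal.span_le.mpr fun b hb ↦ ?_
    by_cases hba : b = a
    · subst hba
      refine (Ideal.unit_mul_mem_iff_mem _ ha).mp ?_
      have : c b * b = x - ∑ a ∈ t.erase b, c a • a := by
        rw [← hc, ← Finset.add_sum_erase t _ hat]
        simp
      rw [this]
      refine Ideal.sub_mem _ (Ideal.subset_span (Set.mem_insert _ _))
        (Ideal.sum_mem _ fun d hd ↦ Ideal.mul_mem_left _ _ (Ideal.subset_span ?_))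
      exact Set.mem_insert_of_mem _ hd
    · exact Ideal.subset_span (Set.mem_insert_of_mem _ (Finset.mem_erase.mpr ⟨hba, hb⟩))

namespace IsRegularLocalRing

open IsLocalRing RingTheory.Sequence

/-- The maximal ideal of a regular local ring of positive dimension has an element that lies
neither in its square nor in any minimal prime. -/
lemma exists_mem_maximalIdeal_notMem {A : Type*} [CommRing A] [IsRegularLocalRing A] {n : ℕ}
    (hn : (maximalIdeal A).spanFinrank = n + 1) :
    ∃ x ∈ maximalIdeal A, x ∉ maximalIdeal A ^ 2 ∧ ∀ p ∈ minimalPrimes A, x ∉ p := by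
  have hdim : ringKrullDim A = (n + 1 : ℕ) := by rw [← spanFinrank_maximalIdeal, hn]
  have hfin : (insert (maximalIdeal A ^ 2) (minimalPrimes A)).Finite :=
    (minimalPrimes.finite_of_isNoetherianRing A).insert _
  by_contra! h
  -- Prime avoidance tolerates two non-prime ideals; `m ^ 2` fills both places.
  obtain ⟨I, hI, hle⟩ := (Ideal.subset_union_prime_finite hfin (f := id) (maximalIdeal A ^ 2)
    (maximalIdeal A ^ 2) (fun p hp hp2 _ ↦ (hp.resolve_left hp2).1.1)
    (I := maximalIdeal A)).mp fun x hx ↦ by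
      by_cases hx2 : x ∈ maximalIdeal A ^ 2
      · exact Set.mem_biUnion (Set.mem_insert _ _) hx2
      · obtain ⟨p, hp, hxp⟩ := h x hx hx2
        exact Set.mem_biUnion (Set.mem_insert_of_mem _ hp) hxp
  obtain rfl | hp := hI
  · have hbot : maximalIdeal A = ⊥ := by
      refine Submodule.eq_bot_of_le_smul_of_le_jacobson_bot (maximalIdeal A) _
        (maximalIdeal A).fg_of_isNoetherianRing ?_ (maximalIdeal_le_jacobson _)
      simpa [pow_two] using hle
    simp [hbot] at hn
  · have := hp.1.1
    have heq : maximalIdeal A = I := le_antisymm hle (le_maximalIdeal_of_isPrime I)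
    have h0 : (maximalIdeal A).height = 0 := by
      rw [heq]
      exact Ideal.height_eq_zero_iff.mpr hp
    rw [← maximalIdeal_height_eq_ringKrullDim, h0] at hdim
    norm_cast at hdim

/-- Completing `x` to `n + 1` generators of `m` leaves `n` generators modulo `x`, while the
dimension drops by at most one; so both numbers equal `n`. -/
lemma quotient_span_singleton {A : Type*} [CommRing A] [IsRegularLocalRing A] {n : ℕ}
    (hn : (maximalIdeal A).spanFinrank = n + 1) {x : A}
    (hx : x ∈ maximalIdeal A) (hx2 : x ∉ maximalIdeal A ^ 2) :
    ∃ _ : IsRegularLocalRing (A ⧸ Ideal.span {x}),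
      (maximalIdeal (A ⧸ Ideal.span {x})).spanFinrank = n := by
  classical
  have hdim : ringKrullDim A = (n + 1 : ℕ) := by rw [← spanFinrank_maximalIdeal, hn]
  obtain ⟨s, hs, hspan⟩ := exists_span_insert_eq_maximalIdeal hn hx hx2
  have : Nontrivial (A ⧸ Ideal.span {x}) := Ideal.Quotient.nontrivial_iff.mpr fun h ↦
    (maximalIdeal.isMaximal A).ne_top (top_le_iff.mp (h ▸ by simpa [Ideal.span_le] using hx))
  have : IsLocalRing (A ⧸ Ideal.span {x}) :=
    .of_surjective' _ Ideal.Quotient.mk_surjective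
  have hmax : maximalIdeal (A ⧸ Ideal.span {x}) =
      Ideal.span (s.image (Ideal.Quotient.mk (Ideal.span {x})) : Set (A ⧸ Ideal.span {x})) := by
    rw [← IsLocalRing.map_maximalIdeal_of_surjective (Ideal.Quotient.mk (Ideal.span {x}))
      Ideal.Quotient.mk_surjective, ← hspan, Ideal.map_span, Set.image_insert_eq,
      Ideal.Quotient.eq_zero_iff_mem.mpr (Ideal.mem_span_singleton_self x), Ideal.span_insert_zero,
      Finset.coe_image]
  have hle : (maximalIdeal (A ⧸ Ideal.span {x})).spanFinrank ≤ n := by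
    rw [hmax]
    refine (Submodule.spanFinrank_span_le_ncard_of_finite (Finset.finite_toSet _)).trans ?_
    rw [Set.ncard_coe_finset]
    exact Finset.card_image_le.trans hs.le
  have hge : (n : WithBot ℕ∞) ≤ ringKrullDim (A ⧸ Ideal.span {x}) := by
    have := ringKrullDim_le_ringKrullDim_quotient_add_card {x}
      (by simpa [ringJacobson_eq_maximalIdeal] using hx)
    rw [hdim, Finset.coe_singleton, Finset.card_singleton] at this
    rwa [Nat.cast_add, Nat.cast_one, ENat.WithBot.add_le_add_one_right_iff] at this
  have hreg : IsRegularLocalRing (A ⧸ Ideal.span {x}) :=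
    of_spanFinrank_maximalIdeal_le _ ((Nat.cast_le.mpr hle).trans hge)
  refine ⟨hreg, le_antisymm hle ?_⟩
  rw [← hreg.spanFinrank_maximalIdeal] at hge
  exact_mod_cast hge

/-- A minimal prime `p` inside the prime `(x)` does not contain `x`, so `p = x p`, and Nakayama
gives `p = 0`. -/
lemma isDomain_of_quotient {A : Type*} [CommRing A] [IsLocalRing A] [IsNoetherianRing A] {x : A}
    (hx : x ∈ maximalIdeal A) (hmin : ∀ p ∈ minimalPrimes A, x ∉ p)
    [IsDomain (A ⧸ Ideal.span {x})] : IsDomain A := by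
  have hprime : (Ideal.span {x}).IsPrime := (Ideal.Quotient.isDomain_iff_prime _).mp inferInstance
  obtain ⟨p, hp, hpx⟩ := Ideal.exists_minimalPrimes_le (I := (⊥ : Ideal A))
    (J := Ideal.span {x}) bot_le
  have hpp : p.IsPrime := hp.1.1
  have hbot : p = ⊥ := by
    refine Submodule.eq_bot_of_le_smul_of_le_jacobson_bot (maximalIdeal A) _
      p.fg_of_isNoetherianRing (fun y hy ↦ ?_) (maximalIdeal_le_jacobson _)
    obtain ⟨z, rfl⟩ := Ideal.mem_span_singleton.mp (hpx hy)
    exact Submodule.smul_mem_smul hx ((hpp.mem_or_mem hy).resolve_left (hmin p hp))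
  exact (isDomain_iff_noZeroDivisors_and_nontrivial A).mpr
    ⟨⟨fun h ↦ by simpa [hbot] using hpp.mem_or_mem (show _ ∈ p by rw [h]; exact p.zero_mem)⟩,
      inferInstance⟩

/-- A regular local ring is a domain, and its maximal ideal is generated by a regular sequence. -/
lemma isDomain_and_exists_isWeaklyRegular {n : ℕ} : ∀ {A : Type u} [CommRing A]
    [IsRegularLocalRing A], (maximalIdeal A).spanFinrank = n → IsDomain A ∧
      ∃ rs : List A, rs.length = n ∧ Ideal.ofList rs = maximalIdeal A ∧ IsWeaklyRegular A rs := by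
  induction n with
  | zero =>
    intro A _ _ hn
    have hbot : maximalIdeal A = ⊥ := (Submodule.spanFinrank_eq_zero_iff_eq_bot
      (maximalIdeal A).fg_of_isNoetherianRing).mp hn
    exact ⟨(isField_iff_maximalIdeal_eq.mpr hbot).isDomain, [], rfl, by simp [hbot], .nil _ _⟩
  | succ n ih =>
    intro A _ _ hn
    obtain ⟨x, hx, hx2, hmin⟩ := exists_mem_maximalIdeal_notMem hn
    obtain ⟨_, hn'⟩ := quotient_span_singleton hn hx hx2
    obtain ⟨_, rs, hlen, hspan, hreg⟩ := ih hn'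
    have := isDomain_of_quotient hx hmin
    obtain ⟨ts, rfl⟩ := List.map_surjective_iff.mpr
      (Ideal.Quotient.mk_surjective (I := Ideal.span {x})) rs
    refine ⟨this, x :: ts, by simpa using hlen, ?_, (isWeaklyRegular_cons_iff _ _ _).mpr ⟨?_, ?_⟩⟩
    · have h := congrArg (Ideal.comap (Ideal.Quotient.mk (Ideal.span {x}))) hspan
      rw [← Ideal.map_ofList, Ideal.comap_map_of_surjective _ Ideal.Quotient.mk_surjective,
        eq_maximalIdeal (Ideal.comap_isMaximal_of_surjective (Ideal.Quotient.mk (Ideal.span {x}))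
          Ideal.Quotient.mk_surjective (K := maximalIdeal _)), ← RingHom.ker_eq_comap_bot,
        Ideal.mk_ker] at h
      rw [Ideal.ofList_cons, sup_comm, h]
    · refine IsSMulRegular.of_ne_zero (fun h ↦ hx2 (h ▸ zero_mem _))
    · exact ((Submodule.quotEquivOfEq _ _ (by simp [← Ideal.submodule_span_eq,
        ← Submodule.ideal_span_singleton_smul])).isWeaklyRegular_congr ts).mpr
        ((isWeaklyRegular_map_algebraMap_iff (A ⧸ Ideal.span {x}) _ ts).mp hreg)

end IsRegularLocalRing

namespace LocalDuality

open IsLocalRing RingTheory.Sequence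

/-! ### Vanishing of Ext below the length of a regular sequence -/

section Vanishing

variable {A : Type u} [CommRing A]

/-- If `rs` is a weakly regular sequence on `M` all of whose elements act
nilpotently on `N`, then `Ext^i(N, M)` vanishes for `i` less than the length of `rs`. -/
lemma subsingleton_ext_of_isWeaklyRegular (N : ModuleCat.{u} A) (rs : List A)
    (hrs : ∀ x ∈ rs, ∃ k, x ^ k ∈ Module.annihilator A N) (M : ModuleCat.{u} A)
    (hM : IsWeaklyRegular M rs) (i : ℕ) (hi : i < rs.length) : Subsingleton (Ext N M i) := by
  induction rs generalizing M i with
  | nil => simp at hi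
  | cons x rs ih =>
    rw [isWeaklyRegular_cons_iff] at hM
    obtain ⟨k, hk⟩ := hrs x List.mem_cons_self
    have hS := hM.1.smulShortComplex_shortExact
    have hf (e : Ext N M i) : e.comp (Ext.mk₀ (M.smulShortComplex x).f) (add_zero i) = x • e := by
      change e.comp (Ext.mk₀ (x • 𝟙 M)) (add_zero i) = x • e
      rw [Ext.mk₀_smul, Ext.comp_smul, Ext.comp_mk₀_id]
    -- The kernel of `x` on `Ext^i(N, M)` is the image of `Ext^{i-1}(N, M / xM)`, zero by induction.
    -- As a power of `x` also kills `N`, everything vanishes.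
    have hinj (e : Ext N M i) (he : x • e = 0) : e = 0 := by
      rw [← hf] at he
      cases i with
      | zero =>
        have := hS.mono_f
        exact Ext.postcomp_mk₀_injective_of_mono N (M.smulShortComplex x).f
          (he.trans (map_zero ((Ext.mk₀ (M.smulShortComplex x).f).postcomp N (add_zero 0))).symm)
      | succ i =>
        have := ih (fun y hy ↦ hrs y (List.mem_cons_of_mem _ hy)) (.of A (QuotSMulTop x M)) hM.2 i
          (by simpa using hi)
        obtain ⟨e', rfl⟩ := Ext.covariant_sequence_exact₁ N hS e he rfl
        rw [show e' = 0 from Subsingleton.elim (α := Ext N (.of A (QuotSMulTop x M)) i) _ _]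
        exact Ext.zero_comp N i hS.extClass _ rfl
    have hpow (n : ℕ) (e : Ext N M i) (he : x ^ n • e = 0) : e = 0 := by
      induction n with
      | zero => simpa using he
      | succ n ihn => exact ihn (hinj _ (by rwa [← mul_smul, ← pow_succ']))
    refine subsingleton_of_forall_eq 0 fun e ↦ hpow k e ?_
    have : x ^ k • 𝟙 N = 0 := by
      ext n
      exact Module.mem_annihilator.mp hk n
    rw [← Ext.mk₀_id_comp e, ← Ext.smul_comp, ← Ext.mk₀_smul, this, Ext.mk₀_zero, Ext.zero_comp]

end Vanishing

/-! ### Modules killed by a power of an ideal -/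

section PowTorsion

variable {A : Type u} [CommRing A]

/-- The module `N` is annihilated by a power of the ideal `J`. -/
def IsPowTorsion (J : Ideal A) (N : ModuleCat.{u} A) : Prop :=
  ∃ k, J ^ k ≤ Module.annihilator A N

lemma isPowTorsion_quotPow (J : Ideal A) (k : ℕ) : IsPowTorsion J (quotPow J k) :=
  ⟨k, (Ideal.annihilator_quotient (I := J ^ k)).ge⟩

lemma IsPowTorsion.of_injective {J : Ideal A} {N N' : ModuleCat.{u} A} (h : IsPowTorsion J N')
    (f : N →ₗ[A] N') (hf : Function.Injective f) : IsPowTorsion J N :=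
  h.imp fun _ hk ↦ hk.trans (f.annihilator_le_of_injective hf)

lemma IsPowTorsion.of_surjective {J : Ideal A} {N N' : ModuleCat.{u} A} (h : IsPowTorsion J N)
    (f : N →ₗ[A] N') (hf : Function.Surjective f) : IsPowTorsion J N' :=
  h.imp fun _ hk ↦ hk.trans (f.annihilator_le_of_surjective hf)

variable {S : ShortComplex (ModuleCat.{u} A)}

lemma _root_.CategoryTheory.ShortComplex.ShortExact.hom_g_surjective (hS : S.ShortExact) :
    Function.Surjective S.g.hom :=
  (ModuleCat.epi_iff_surjective _).mp hS.epi_g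

variable [IsLocalRing A] [IsNoetherianRing A]

/-- Dévissage of the finitely generated modules over a Noetherian local ring that are annihilated
by a power of the maximal ideal: they are iterated extensions of the residue field. -/
lemma devissage {P : ModuleCat.{u} A → Prop}
    (subsingleton : ∀ N : ModuleCat.{u} A, Subsingleton N → P N)
    (quotient : ∀ N : ModuleCat.{u} A, (N ≃ₗ[A] A ⧸ maximalIdeal A) → P N)
    (extension : ∀ S : ShortComplex (ModuleCat.{u} A), S.ShortExact → Module.Finite A S.X₁ →
      Module.Finite A S.X₂ → Module.Finite A S.X₃ → IsPowTorsion (maximalIdeal A) S.X₁ →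
      IsPowTorsion (maximalIdeal A) S.X₂ → IsPowTorsion (maximalIdeal A) S.X₃ →
      P S.X₁ → P S.X₃ → P S.X₂)
    (N : ModuleCat.{u} A) (hfin : Module.Finite A N) (hN : IsPowTorsion (maximalIdeal A) N) :
    P N := by
  suffices h : IsPowTorsion (maximalIdeal A) (.of A N) → P (.of A N) from h hN
  refine IsNoetherianRing.induction_on_isQuotientEquivQuotientPrime
    (motive := fun N _ _ _ ↦ IsPowTorsion (maximalIdeal A) (.of A N) → P (.of A N)) A hfin
    (fun N _ _ _ _ _ ↦ subsingleton (.of A N) ‹_›) ?_ ?_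
  · rintro N _ _ _ p e ⟨k, hk⟩
    have hp : p.1 = maximalIdeal A := by
      refine le_antisymm (le_maximalIdeal p.2.ne_top) ?_
      refine Ideal.IsPrime.le_of_pow_le (hP := p.2) (n := k) (hk.trans ?_)
      exact (e.annihilator_eq.trans Ideal.annihilator_quotient).le
    exact quotient (.of A N) (e.trans (Submodule.quotEquivOfEq _ _ hp))
  · intro N₁ _ _ _ N₂ _ _ _ N₃ _ _ _ f g hf hg hfg h₁ h₃ h
    have t₁ := IsPowTorsion.of_injective (N := .of A N₁) h f hf
    have t₃ := IsPowTorsion.of_surjective (N' := .of A N₃) h g hg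
    refine extension (ModuleCat.shortComplexOfCompEqZero f g hfg.linearMap_comp_eq_zero)
      (ModuleCat.shortComplex_shortExact _ hfg hf hg) ?_ ?_ ?_ t₁ h t₃ (h₁ t₁) (h₃ t₃) <;>
    assumption

end PowTorsion

/-! ### Ext concentrated in degree `r` -/

section Ext

variable {A : Type u} [CommRing A] [IsRegularLocalRing A] {r : ℕ}

lemma subsingleton_ext_of_isPowTorsion_of_lt (hr : ringKrullDim A = r) (N : ModuleCat.{u} A)
    (hN : IsPowTorsion (maximalIdeal A) N) (i : ℕ) (hi : i < r) :
    Subsingleton (Ext N (.of A A) i) := by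
  rw [← IsRegularLocalRing.spanFinrank_maximalIdeal] at hr
  obtain ⟨-, rs, hlen, hspan, hreg⟩ :=
    IsRegularLocalRing.isDomain_and_exists_isWeaklyRegular (Nat.cast_injective hr)
  obtain ⟨k, hk⟩ := hN
  exact subsingleton_ext_of_isWeaklyRegular N rs (fun x hx ↦ ⟨k, hk (Ideal.pow_mem_pow
    (hspan ▸ Ideal.subset_span hx) k)⟩) (.of A A) hreg i (hlen ▸ hi)

/-- The residue field is `A` modulo a regular sequence of length `r`, hence of projective dimension
`r`; the bound passes to extensions. -/
lemma hasProjectiveDimensionLT_of_isPowTorsion (hr : ringKrullDim A = r) (N : ModuleCat.{u} A)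
    [hfin : Module.Finite A N] (hN : IsPowTorsion (maximalIdeal A) N) :
    HasProjectiveDimensionLT N (r + 1) := by
  rw [← IsRegularLocalRing.spanFinrank_maximalIdeal] at hr
  obtain ⟨-, rs, hlen, hspan, hreg⟩ :=
    IsRegularLocalRing.isDomain_and_exists_isWeaklyRegular (Nat.cast_injective hr)
  refine devissage (P := fun N ↦ HasProjectiveDimensionLT N (r + 1)) (fun N h ↦ ?_)
    (fun N e ↦ ?_) (fun S hS _ _ _ _ _ _ h₁ h₃ ↦ hS.hasProjectiveDimensionLT_X₂ _ h₁ h₃) N hfin hN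
  · have := (ModuleCat.isZero_of_subsingleton N).hasProjectiveDimensionLT_zero
    exact hasProjectiveDimensionLT_of_ge N 0 _ (Nat.zero_le _)
  · have h := ModuleCat.projectiveDimension_quotient_eq_add_length_of_isWeaklyRegular
      (.of A A) rs hreg fun x hx ↦ hspan ▸ Ideal.subset_span hx
    rw [hspan, hlen, ModuleCat.projectiveDimension_eq_zero_of_projective (.of A A), zero_add] at h
    have := (projectiveDimension_le_iff _ r).mp h.le
    have h' : maximalIdeal A • (⊤ : Submodule A A) = maximalIdeal A := by simp
    exact hasProjectiveDimensionLT_of_iso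
      (e.trans (Submodule.quotEquivOfEq _ _ h'.symm)).symm.toModuleIso (r + 1)

end Ext

/-! ### Homomorphisms into local cohomology given by Ext classes -/

section Represents

variable {A : Type u} [CommRing A] {J : Ideal A} {M : ModuleCat.{u} A} {i : ℕ}

lemma toLocalCohomology_extTransition {k l : ℕ} (h : k ≤ l) (α : Ext (quotPow J k) M i) :
    toLocalCohomology J M i l ((Ext.mk₀ (quotPowMap J h)).comp α (zero_add i)) =
      toLocalCohomology J M i k α :=
  Module.DirectLimit.of_f (f := extTransition J M i) (hij := h) (x := α)

lemma exists_toLocalCohomology (z : LocalCohomology J M i) (n : ℕ) :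
    ∃ k, n ≤ k ∧ ∃ α, toLocalCohomology J M i k α = z := by
  obtain ⟨k, α, rfl⟩ := Module.DirectLimit.exists_of z
  exact ⟨max n k, le_max_left _ _, _, toLocalCohomology_extTransition (le_max_right n k) α⟩

lemma exists_comp_eq_zero_of_toLocalCohomology_eq_zero {k : ℕ} {α : Ext (quotPow J k) M i}
    (h : toLocalCohomology J M i k α = 0) :
    ∃ l, ∃ hkl : k ≤ l, (Ext.mk₀ (quotPowMap J hkl)).comp α (zero_add i) = 0 :=
  Module.DirectLimit.of.zero_exact (f := extTransition J M i) h

lemma exists_pow_smul_eq_zero (z : LocalCohomology J M i) : ∃ k, ∀ a ∈ J ^ k, a • z = 0 := by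
  obtain ⟨k, -, α, rfl⟩ := exists_toLocalCohomology z 0
  refine ⟨k, fun a ha ↦ ?_⟩
  have : a • 𝟙 (quotPow J k) = 0 := by
    refine ModuleCat.hom_ext (LinearMap.ext fun x ↦ ?_)
    exact Module.mem_annihilator.mp (Ideal.annihilator_quotient.ge ha) x
  rw [← map_smul, ← Ext.mk₀_id_comp α, ← Ext.smul_comp, ← Ext.mk₀_smul, this, Ext.mk₀_zero,
    Ext.zero_comp, map_zero]

lemma exists_pow_smul_eq_zero_of_finite {X : Type u} [AddCommGroup X] [Module A X] [Module.Finite A X]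
    (f : X →ₗ[A] LocalCohomology J M i) : ∃ k, ∀ a ∈ J ^ k, ∀ x, a • f x = 0 := by
  obtain ⟨s, hs⟩ := Module.Finite.fg_top (R := A) (M := X)
  choose k hk using fun x ↦ exists_pow_smul_eq_zero (f x)
  refine ⟨s.sup k, fun a ha x ↦ ?_⟩
  have : ⊤ ≤ LinearMap.ker (a • f) := by
    rw [← hs, Submodule.span_le]
    exact fun x hx ↦ hk x a (Ideal.pow_le_pow_right (Finset.le_sup hx) ha)
  exact this (Submodule.mem_top (x := x))

variable {N : ModuleCat.{u} A}

lemma quotPow_hom_ext {k : ℕ} {g g' : quotPow J k ⟶ N}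
    (h : g.hom (1 : A ⧸ J ^ k) = g'.hom (1 : A ⧸ J ^ k)) : g = g' := by
  refine ModuleCat.hom_ext (Submodule.linearMap_qext _ (LinearMap.ext_ring h))

lemma exists_quotPow_hom {k : ℕ} (hk : J ^ k ≤ Module.annihilator A N) (n : N) :
    ∃ g : quotPow J k ⟶ N, g.hom (1 : A ⧸ J ^ k) = n := by
  refine ⟨ModuleCat.ofHom (Submodule.liftQ _ (LinearMap.toSpanSingleton A N n) fun a ha ↦ ?_), ?_⟩
  · exact Module.mem_annihilator.mp (hk ha) n
  · exact (Submodule.liftQ_apply _ _ (1 : A)).trans (one_smul A n)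

/-- After restriction to a common `A / J ^ max k l` the two maps agree on `1`. This makes the map in
`exists_represents` well defined and linear. -/
lemma toLocalCohomology_mk₀_comp_congr (β : Ext N M i) {k l : ℕ} {g : quotPow J k ⟶ N}
    {g' : quotPow J l ⟶ N} (h : g.hom (1 : A ⧸ J ^ k) = g'.hom (1 : A ⧸ J ^ l)) :
    toLocalCohomology J M i k ((Ext.mk₀ g).comp β (zero_add i)) =
      toLocalCohomology J M i l ((Ext.mk₀ g').comp β (zero_add i)) := by
  rw [← toLocalCohomology_extTransition (le_max_left k l),
    ← toLocalCohomology_extTransition (le_max_right k l), Ext.mk₀_comp_mk₀_assoc,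
    Ext.mk₀_comp_mk₀_assoc]
  congr 3
  exact quotPow_hom_ext h

/-- The homomorphism `f : N → H^i_J(M)` is the one that sends the image `n` of `1` under
`g : A / J ^ k → N` to the class of `β ∘ g` in `H^i_J(M)`. -/
def Represents (β : Ext N M i) (f : N →ₗ[A] LocalCohomology J M i) : Prop :=
  ∀ (k : ℕ) (g : quotPow J k ⟶ N),
    toLocalCohomology J M i k ((Ext.mk₀ g).comp β (zero_add i)) = f (g.hom (1 : A ⧸ J ^ k))

lemma exists_represents (hN : IsPowTorsion J N) (β : Ext N M i) :
    ∃ f : N →ₗ[A] LocalCohomology J M i, Represents β f := by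
  obtain ⟨k, hk⟩ := hN
  choose g hg using exists_quotPow_hom hk
  refine ⟨{ toFun n := toLocalCohomology J M i k ((Ext.mk₀ (g n)).comp β (zero_add i))
            map_add' n n' := ?_
            map_smul' a n := ?_ }, fun l g' ↦ toLocalCohomology_mk₀_comp_congr β (hg _).symm⟩
  · rw [← map_add, ← Ext.add_comp, ← Ext.mk₀_add]
    refine toLocalCohomology_mk₀_comp_congr β ?_
    simp [hg]
  · rw [RingHom.id_apply, ← map_smul, ← Ext.smul_comp, ← Ext.mk₀_smul]
    refine toLocalCohomology_mk₀_comp_congr β ?_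
    simp [hg]

namespace Represents

variable {β β' : Ext N M i} {f f' : N →ₗ[A] LocalCohomology J M i}

lemma unique (hN : IsPowTorsion J N) (h : Represents β f) (h' : Represents β f') : f = f' := by
  obtain ⟨k, hk⟩ := hN
  ext n
  obtain ⟨g, rfl⟩ := exists_quotPow_hom hk n
  rw [← h, ← h']

lemma add (h : Represents β f) (h' : Represents β' f') : Represents (β + β') (f + f') :=
  fun k g ↦ by rw [Ext.comp_add, map_add, h, h', LinearMap.add_apply]

lemma precomp (h : Represents β f) {N' : ModuleCat.{u} A} (p : N' ⟶ N) :
    Represents ((Ext.mk₀ p).comp β (zero_add i)) (f ∘ₗ p.hom) :=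
  fun k g ↦ by rw [Ext.mk₀_comp_mk₀_assoc, h]; rfl

end Represents

end Represents

lemma _root_.CategoryTheory.ShortComplex.ShortExact.hom_exact {A : Type u} [CommRing A]
    {S : ShortComplex (ModuleCat.{u} A)} (hS : S.ShortExact) :
    Function.Exact S.f.hom S.g.hom :=
  (ShortComplex.ShortExact.moduleCat_exact_iff_function_exact S).mp hS.exact

/-! ### Injectivity of `H^r_m(A)` -/

section Injective

variable {A : Type u} [CommRing A] [IsRegularLocalRing A] {r : ℕ} (hr : ringKrullDim A = r)
  {S : ShortComplex (ModuleCat.{u} A)} (hS : S.ShortExact)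

include hr hS in
-- The obstruction comes from `Ext^{r-1}(S.X₁, A) = 0`.
lemma eq_zero_of_mk₀_g_comp_eq_zero (h₁ : IsPowTorsion (maximalIdeal A) S.X₁)
    (β : Ext S.X₃ (.of A A) r) (h : (Ext.mk₀ S.g).comp β (zero_add r) = 0) : β = 0 := by
  cases r with
  | zero =>
    have := hS.epi_g
    exact Ext.precomp_mk₀_injective_of_epi _ S.g
      (h.trans (map_zero ((Ext.mk₀ S.g).precomp (.of A A) (zero_add 0))).symm)
  | succ r =>
    obtain ⟨β', rfl⟩ := Ext.contravariant_sequence_exact₃ hS _ β h (add_comm 1 r)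
    have := subsingleton_ext_of_isPowTorsion_of_lt hr _ h₁ r r.lt_succ_self
    rw [Subsingleton.elim β' 0, Ext.comp_zero]

include hr hS in
-- The obstruction lies in `Ext^{r+1}(S.X₃, A) = 0`.
lemma exists_mk₀_f_comp_eq (hfin : Module.Finite A S.X₃)
    (h₃ : IsPowTorsion (maximalIdeal A) S.X₃) (β : Ext S.X₁ (.of A A) r) :
    ∃ β' : Ext S.X₂ (.of A A) r, (Ext.mk₀ S.f).comp β' (zero_add r) = β := by
  have := hasProjectiveDimensionLT_of_isPowTorsion hr S.X₃ h₃
  exact Ext.contravariant_sequence_exact₁ hS _ β (add_comm 1 r)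
    (Ext.eq_zero_of_hasProjectiveDimensionLT _ (r + 1) le_rfl)

include hr in
-- The kernel of `A / m^l → A / m^k` is killed by a power of `m`, so the transition maps in degree
-- `r` are injective.
lemma toLocalCohomology_injective (k : ℕ) :
    Function.Injective (toLocalCohomology (maximalIdeal A) (.of A A) r k) := by
  refine (injective_iff_map_eq_zero _).mpr fun α hα ↦ ?_
  obtain ⟨l, hkl, h⟩ := exists_comp_eq_zero_of_toLocalCohomology_eq_zero hα
  have hS := LinearMap.shortExact_shortComplexKer (f := (quotPowMap (maximalIdeal A) hkl).hom)
    (Submodule.factor_surjective (Ideal.pow_le_pow_right hkl))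
  exact eq_zero_of_mk₀_g_comp_eq_zero hr hS ((isPowTorsion_quotPow _ l).of_injective _
    (Submodule.subtype_injective _)) α h

include hr in
lemma Represents.eq_zero (N : ModuleCat.{u} A) [hfin : Module.Finite A N]
    (hN : IsPowTorsion (maximalIdeal A) N) (β : Ext N (.of A A) r)
    (hβ : Represents (J := maximalIdeal A) β 0) : β = 0 := by
  revert β
  refine devissage (P := fun N ↦ ∀ β : Ext N (.of A A) r, Represents (J := maximalIdeal A) β 0 →
    β = 0) (fun N hN β hβ ↦ ?_) (fun N e β hβ ↦ ?_)
    (fun S hS _ _ _ t₁ t₂ t₃ h₁ h₃ β hβ ↦ ?_) N hfin hN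
  · rw [← Ext.mk₀_id_comp β, (ModuleCat.isZero_of_subsingleton N).eq_of_src (𝟙 N) 0, Ext.mk₀_zero,
      Ext.zero_comp]
  · let e' : quotPow (maximalIdeal A) 1 ≅ N :=
      ((Submodule.quotEquivOfEq _ _ (pow_one (maximalIdeal A))).trans e.symm).toModuleIso
    have h := toLocalCohomology_injective hr 1 ((hβ 1 e'.hom).trans (map_zero _).symm)
    rw [← Ext.mk₀_id_comp β, ← e'.inv_hom_id, ← Ext.mk₀_comp_mk₀_assoc, h, Ext.comp_zero]
  · obtain ⟨β₃, rfl⟩ := Ext.contravariant_sequence_exact₂ hS _ β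
      (h₁ _ (by simpa using hβ.precomp S.f))
    rw [h₃ β₃, Ext.comp_zero]
    -- The map given by `β₃` vanishes after composition with the surjection `S.g`, hence vanishes.
    obtain ⟨f, hf⟩ := exists_represents t₃ β₃
    obtain rfl : f = 0 := by
      have := (hf.precomp S.g).unique t₂ hβ
      exact LinearMap.cancel_right hS.hom_g_surjective |>.mp (this.trans (LinearMap.zero_comp _).symm)
    exact hf

include hr in
-- The element `f 1` comes from some `ζ` over `A / m^l`, which represents `f ∘ π`. This is zero on
-- `ker π`, so `ζ` restricts to zero there by `Represents.eq_zero` and descends to `A / m`.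
lemma exists_represents_residueField (f : (A ⧸ maximalIdeal A) →ₗ[A] DualizingModule A r) :
    ∃ β : Ext (.of A (A ⧸ maximalIdeal A)) (.of A A) r, Represents β f := by
  -- The bound `1 ≤ l` ensures `m^l ≤ m`.
  obtain ⟨l, hl, ζ, hζ⟩ := exists_toLocalCohomology (f 1) 1
  have hle : maximalIdeal A ^ l ≤ maximalIdeal A := Ideal.pow_le_self (Nat.one_le_iff_ne_zero.mp hl)
  let π : (A ⧸ maximalIdeal A ^ l) →ₗ[A] A ⧸ maximalIdeal A := Submodule.factor hle
  have hS := LinearMap.shortExact_shortComplexKer (f := π) (Submodule.factor_surjective _)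
  obtain ⟨F, hF⟩ := exists_represents (isPowTorsion_quotPow (maximalIdeal A) l) ζ
  have hF1 : F (1 : A ⧸ maximalIdeal A ^ l) = f 1 := by
    rw [← hζ, ← Ext.mk₀_id_comp ζ, hF]
    rfl
  have hFπ : F = f ∘ₗ π := Submodule.linearMap_qext _ (LinearMap.ext_ring hF1)
  have hker : (Ext.mk₀ π.shortComplexKer.f).comp ζ (zero_add r) = 0 := by
    have : Module.Finite A π.shortComplexKer.X₁ :=
      inferInstanceAs (Module.Finite A (LinearMap.ker π))
    refine Represents.eq_zero hr _ ((isPowTorsion_quotPow _ l).of_injective _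
      (Submodule.subtype_injective (LinearMap.ker π))) _ ?_
    convert hF.precomp π.shortComplexKer.f
    rw [hFπ]
    ext ⟨x, hx⟩
    change 0 = f (π x)
    rw [LinearMap.mem_ker.mp hx, map_zero]
  obtain ⟨β, hβ⟩ := Ext.contravariant_sequence_exact₂ hS _ ζ hker
  refine ⟨β, ?_⟩
  obtain ⟨f', hf'⟩ := exists_represents (J := maximalIdeal A) ⟨1, by
    rw [pow_one]
    exact Ideal.annihilator_quotient.ge⟩ β
  have h := hF.unique (isPowTorsion_quotPow (maximalIdeal A) l)
    (hβ ▸ hf'.precomp π.shortComplexKer.g)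
  rw [hFπ] at h
  rwa [(LinearMap.cancel_right (Submodule.factor_surjective hle)).mp h]

include hr in
/-- Every homomorphism `N → H^r_m(A)` from a module of finite length is given by an element of
`Ext^r(N, A)`. -/
lemma exists_represents_of_isPowTorsion (N : ModuleCat.{u} A) [hfin : Module.Finite A N]
    (hN : IsPowTorsion (maximalIdeal A) N) (f : N →ₗ[A] DualizingModule A r) :
    ∃ β : Ext N (.of A A) r, Represents β f := by
  revert f
  refine devissage (P := fun N ↦ ∀ f : N →ₗ[A] DualizingModule A r,
    ∃ β : Ext N (.of A A) r, Represents β f) (fun N hN f ↦ ⟨0, fun k g ↦ ?_⟩) (fun N e f ↦ ?_)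
    (fun S hS _ _ _ t₁ t₂ t₃ h₁ h₃ f ↦ ?_) N hfin hN
  · rw [Ext.comp_zero, map_zero, Subsingleton.elim (g.hom _) 0, map_zero]
  · obtain ⟨β, hβ⟩ := exists_represents_residueField hr (f ∘ₗ e.symm.toLinearMap)
    refine ⟨(Ext.mk₀ (ModuleCat.ofHom e.toLinearMap)).comp β (zero_add r), ?_⟩
    convert hβ.precomp (ModuleCat.ofHom e.toLinearMap)
    ext
    simp
  · obtain ⟨β₁, hβ₁⟩ := h₁ (f ∘ₗ S.f.hom)
    obtain ⟨β₂, rfl⟩ := exists_mk₀_f_comp_eq hr hS ‹_› t₃ β₁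
    obtain ⟨f₂, hf₂⟩ := exists_represents t₂ β₂
    -- Subtracting a lift of the class of `f` on `S.X₁` leaves a map that factors through `S.X₃`.
    have h₂ : (f - f₂) ∘ₗ S.f.hom = 0 := by
      rw [LinearMap.sub_comp, hβ₁.unique t₁ (hf₂.precomp S.f), sub_self]
    have hker : LinearMap.ker S.g.hom ≤ LinearMap.ker (f - f₂) := by
      rw [LinearMap.exact_iff.mp hS.hom_exact]
      exact LinearMap.range_le_ker_iff.mpr h₂
    let e := S.g.hom.quotKerEquivOfSurjective hS.hom_g_surjective
    obtain ⟨β₃, hβ₃⟩ := h₃ ((LinearMap.ker S.g.hom).liftQ (f - f₂) hker ∘ₗ e.symm.toLinearMap)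
    refine ⟨β₂ + (Ext.mk₀ S.g).comp β₃ (zero_add r), ?_⟩
    convert hf₂.add (hβ₃.precomp S.g)
    ext x
    have : e.symm (S.g.hom x) = Submodule.Quotient.mk x := e.symm_apply_eq.mpr rfl
    simp [this]

include hr in
/-- The module `H^r_m(A)` is injective. -/
lemma injective_dualizingModule : Module.Injective A (DualizingModule A r) := by
  refine Module.Baer.injective fun I f ↦ ?_
  obtain ⟨n, hn⟩ := exists_pow_smul_eq_zero_of_finite f
  obtain ⟨c, hc⟩ := (maximalIdeal A).exists_pow_inf_eq_pow_smul (M := A) I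
  -- By Artin–Rees `I ∩ m^(n + c) ⊆ m^n I`, which `f` kills. So `f` factors through a submodule of
  -- `A / m^(n + c)`, where Ext classes extend.
  have hf : (Submodule.comap I.subtype (maximalIdeal A ^ (n + c))) ≤ LinearMap.ker f := by
    intro x hx
    have hx' : (x : A) ∈ maximalIdeal A ^ n • I := by
      have := (hc (n + c) (Nat.le_add_left c n)).le
        ⟨by simpa using hx, x.2⟩
      rw [Nat.add_sub_cancel] at this
      exact Submodule.smul_mono le_rfl inf_le_right this
    have hle : maximalIdeal A ^ n • (⊤ : Submodule A I) ≤ LinearMap.ker f :=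
      Submodule.smul_le.mpr fun a ha y _ ↦ by rw [LinearMap.mem_ker, map_smul, hn a ha]
    obtain ⟨y, hy, hyx⟩ : (x : A) ∈ Submodule.map I.subtype (maximalIdeal A ^ n • ⊤) := by
      rwa [Submodule.map_smul'', Submodule.map_top, I.range_subtype]
    exact Subtype.ext hyx ▸ hle hy
  let ι : (I ⧸ Submodule.comap I.subtype (maximalIdeal A ^ (n + c))) →ₗ[A]
      A ⧸ maximalIdeal A ^ (n + c) := Submodule.mapQ _ _ I.subtype le_rfl
  have hι : Function.Injective ι := by
    rw [← LinearMap.ker_eq_bot]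
    exact Submodule.ker_liftQ_eq_bot _ _ _ (by rw [LinearMap.ker_comp, Submodule.ker_mkQ])
  have hS := ModuleCat.shortComplex_shortExact (ModuleCat.shortComplexOfCompEqZero ι
    (LinearMap.range ι).mkQ (LinearMap.range_mkQ_comp ι))
    (LinearMap.exact_map_mkQ_range ι) hι (Submodule.mkQ_surjective _)
  have t₂ := isPowTorsion_quotPow (maximalIdeal A) (n + c)
  have t₁ := t₂.of_injective (N := .of A _) ι hι
  obtain ⟨β₁, hβ₁⟩ := exists_represents_of_isPowTorsion hr (.of A _) t₁ (Submodule.liftQ _ f hf)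
  obtain ⟨β₂, rfl⟩ := exists_mk₀_f_comp_eq hr hS
    (inferInstanceAs (Module.Finite A (_ ⧸ LinearMap.range ι)))
    (t₂.of_surjective (N' := .of A (_ ⧸ LinearMap.range ι)) _ (Submodule.mkQ_surjective _)) β₁
  obtain ⟨f₂, hf₂⟩ := exists_represents t₂ β₂
  have h := hβ₁.unique t₁ (hf₂.precomp (ModuleCat.ofHom ι))
  refine ⟨f₂ ∘ₗ Submodule.mkQ _, fun x hx ↦ ?_⟩
  exact (LinearMap.congr_fun h (Submodule.Quotient.mk ⟨x, hx⟩)).symm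

end Injective

/-! ### Long exact sequence of local cohomology -/

section LongExactSequence

variable {A : Type u} [CommRing A] (J : Ideal A) {M P Q : ModuleCat.{u} A}

/-- Local cohomology turns an exact sequence of Yoneda products into an exact sequence. -/
lemma exists_yonedaAction_eq {m n a b c : ℕ} (β : Ext M P m) (γ : Ext P Q n) (h : a + m = b)
    (h' : b + n = c)
    (hex : ∀ (X : ModuleCat.{u} A) (x : Ext X P b), x.comp γ h' = 0 →
      ∃ y : Ext X M a, y.comp β h = x)
    (z : LocalCohomology J P b) (hz : yonedaAction J γ h' z = 0) :
    ∃ y, yonedaAction J β h y = z := by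
  obtain ⟨k, -, x, rfl⟩ := exists_toLocalCohomology z 0
  rw [yonedaAction_toLocalCohomology] at hz
  -- A product that is zero in the limit is already zero over some `A / J^l`; exactness of Ext
  -- applies there.
  obtain ⟨l, hkl, hl⟩ := exists_comp_eq_zero_of_toLocalCohomology_eq_zero hz
  rw [← Ext.comp_assoc _ _ _ (zero_add b) h' (by omega)] at hl
  obtain ⟨y, hy⟩ := hex _ _ hl
  exact ⟨toLocalCohomology J M a l y, by
    rw [yonedaAction_toLocalCohomology, hy, toLocalCohomology_extTransition]⟩

lemma yonedaAction_yonedaAction {m n a b c : ℕ} (β : Ext M P m) (γ : Ext P Q n) (h : a + m = b)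
    (h' : b + n = c) (z : LocalCohomology J M a) :
    yonedaAction J γ h' (yonedaAction J β h z) =
      yonedaAction J (β.comp γ rfl) (by omega : a + (m + n) = c) z := by
  obtain ⟨k, -, x, rfl⟩ := exists_toLocalCohomology z 0
  simp only [yonedaAction_toLocalCohomology]
  rw [Ext.comp_assoc _ _ _ h rfl (by omega)]

lemma LocalCohomology.map_map (f : M ⟶ P) (g : P ⟶ Q) (i : ℕ) (z : LocalCohomology J M i) :
    map J g i (map J f i z) = map J (f ≫ g) i z := by
  rw [map, map, map, yonedaAction_yonedaAction]
  congr 2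
  exact Ext.mk₀_comp_mk₀ f g

lemma LocalCohomology.map_id (i : ℕ) (z : LocalCohomology J M i) : map J (𝟙 M) i z = z := by
  obtain ⟨k, -, x, rfl⟩ := exists_toLocalCohomology z 0
  rw [map, yonedaAction_toLocalCohomology, Ext.comp_mk₀_id]

lemma LocalCohomology.map_sum {ι : Type*} (s : Finset ι) (f : ι → (M ⟶ P)) (i : ℕ)
    (z : LocalCohomology J M i) : map J (∑ t ∈ s, f t) i z = ∑ t ∈ s, map J (f t) i z := by
  obtain ⟨k, -, x, rfl⟩ := exists_toLocalCohomology z 0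
  simp only [map, yonedaAction_toLocalCohomology, ← _root_.map_sum]
  congr 1
  exact _root_.map_sum ((Ext.bilinearComp (quotPow J k) M P i 0 i (add_zero i) x).comp
    (Ext.addEquiv₀.symm : (M ⟶ P) ≃+ Ext M P 0).toAddMonoidHom) f s

variable {S : ShortComplex (ModuleCat.{u} A)} (hS : S.ShortExact)

include hS in
lemma LocalCohomology.exact_map_map (i : ℕ) :
    Function.Exact (map J S.f i) (map J S.g i) := by
  refine fun z ↦ ⟨exists_yonedaAction_eq J _ _ _ _ (fun X ↦ Ext.covariant_sequence_exact₂ X hS) z, ?_⟩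
  rintro ⟨y, rfl⟩
  -- The zero map is treated as an empty sum, so that additivity applies.
  rw [map_map, S.zero, ← Finset.sum_empty (f := fun t : Empty ↦ t.elim), map_sum, Finset.sum_empty]

lemma LocalCohomology.exists_map_eq (i : ℕ) (z : LocalCohomology J S.X₃ i) (hz : δ J hS i z = 0) :
    ∃ y, map J S.g i y = z :=
  exists_yonedaAction_eq J _ _ _ _ (fun X x hx ↦ Ext.covariant_sequence_exact₃ X hS x _ hx) z hz

lemma LocalCohomology.exists_δ_eq (i : ℕ) (z : LocalCohomology J S.X₁ (i + 1))
    (hz : map J S.f (i + 1) z = 0) : ∃ y, δ J hS i y = z :=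
  exists_yonedaAction_eq J _ _ _ _ (fun X x hx ↦ Ext.covariant_sequence_exact₁ X hS x hx _) z hz

end LongExactSequence

/-! ### Compatibility of `φ` with maps, connecting homomorphisms and sums -/

section DeltaFunctor

variable {A : Type u} [CommRing A] [IsLocalRing A] {r : ℕ}

lemma φ_map (M M' : ModuleCat.{u} A) (f : M ⟶ M') (i j : ℕ) (h : i + j = r) :
    φ M' i j h ∘ₗ LocalCohomology.map (maximalIdeal A) f i =
      D.map A r (extMap f (.of A A) j) ∘ₗ φ M i j h := by
  refine LinearMap.ext fun z ↦ LinearMap.ext fun β ↦ ?_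
  obtain ⟨k, -, α, rfl⟩ := exists_toLocalCohomology z 0
  change φ M' i j h (yonedaAction _ _ _ _) β =
    φ M i j h (toLocalCohomology _ _ _ _ _) ((Ext.mk₀ f).comp β (zero_add j))
  rw [yonedaAction_toLocalCohomology, φ_toLocalCohomology, φ_toLocalCohomology,
    Ext.comp_assoc _ _ _ (add_zero i) (zero_add j) (by omega)]

lemma φ_δ {S : ShortComplex (ModuleCat.{u} A)} (hS : S.ShortExact) (i j : ℕ)
    (h : (i + 1) + j = r) (h' : i + (j + 1) = r) :
    φ S.X₁ (i + 1) j h ∘ₗ LocalCohomology.δ (maximalIdeal A) hS i =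
      D.map A r (extδ hS (.of A A) j) ∘ₗ φ S.X₃ i (j + 1) h' := by
  refine LinearMap.ext fun z ↦ LinearMap.ext fun β ↦ ?_
  obtain ⟨k, -, α, rfl⟩ := exists_toLocalCohomology z 0
  change φ S.X₁ (i + 1) j h (yonedaAction _ _ _ _) β =
    φ S.X₃ i (j + 1) h' (toLocalCohomology _ _ _ _ _) (hS.extClass.comp β (add_comm 1 j))
  rw [yonedaAction_toLocalCohomology, φ_toLocalCohomology, φ_toLocalCohomology,
    Ext.comp_assoc _ _ _ rfl (add_comm 1 j) (by omega)]

lemma φ_map_apply {M M' : ModuleCat.{u} A} (f : M ⟶ M') (i j : ℕ) (h : i + j = r)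
    (z : LocalCohomology (maximalIdeal A) M i) :
    φ M' i j h (LocalCohomology.map (maximalIdeal A) f i z) =
      D.map A r (extMap f (.of A A) j) (φ M i j h z) :=
  LinearMap.congr_fun (φ_map M M' f i j h) z

lemma φ_δ_apply {S : ShortComplex (ModuleCat.{u} A)} (hS : S.ShortExact) (i j : ℕ)
    (h : (i + 1) + j = r) (h' : i + (j + 1) = r) (z : LocalCohomology (maximalIdeal A) S.X₃ i) :
    φ S.X₁ (i + 1) j h (LocalCohomology.δ (maximalIdeal A) hS i z) =
      D.map A r (extδ hS (.of A A) j) (φ S.X₃ i (j + 1) h' z) :=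
  LinearMap.congr_fun (φ_δ hS i j h h') z

/-- If `φ` is bijective for `M`, then it is bijective for every module `N` whose identity is a sum of
endomorphisms that factor through `M`. -/
lemma φ_bijective_of_sum_eq_id {M N : ModuleCat.{u} A} {ι : Type*} [Fintype ι] (p : ι → (N ⟶ M))
    (q : ι → (M ⟶ N)) (hpq : ∑ t, p t ≫ q t = 𝟙 N) (i j : ℕ) (h : i + j = r)
    (hM : Function.Bijective (φ M i j h)) : Function.Bijective (φ N i j h) := by
  have hsum (z : LocalCohomology (maximalIdeal A) N i) :
      ∑ t, LocalCohomology.map _ (q t) i (LocalCohomology.map _ (p t) i z) = z := by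
    simp_rw [LocalCohomology.map_map]
    rw [← LocalCohomology.map_sum, hpq, LocalCohomology.map_id]
  have hsum' (y : D A r (Ext N (.of A A) j)) :
      ∑ t, D.map A r (extMap (q t) _ j) (D.map A r (extMap (p t) _ j) y) = y := by
    ext β
    rw [LinearMap.sum_apply]
    change ∑ t, y ((Ext.mk₀ (p t)).comp ((Ext.mk₀ (q t)).comp β (zero_add j)) (zero_add j)) = y β
    simp_rw [Ext.mk₀_comp_mk₀_assoc]
    have : ∑ t, (Ext.mk₀ (p t ≫ q t)).comp β (zero_add j) = β := by
      conv_rhs => rw [← Ext.mk₀_id_comp β, ← hpq]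
      exact (_root_.map_sum (((Ext.bilinearComp N N (.of A A) 0 j j (zero_add j)).flip β).comp
        (Ext.addEquiv₀.symm : (N ⟶ N) ≃+ Ext N N 0).toAddMonoidHom) _ _).symm
    rw [← map_sum, this]
  refine ⟨(injective_iff_map_eq_zero _).mpr fun z hz ↦ ?_, fun y ↦ ?_⟩
  · rw [← hsum z]
    refine Finset.sum_eq_zero fun t _ ↦ ?_
    have : LocalCohomology.map _ (p t) i z = 0 :=
      (injective_iff_map_eq_zero _).mp hM.1 _ (by rw [φ_map_apply, hz, map_zero])
    rw [this, map_zero]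
  · choose z hz using fun t ↦ hM.2 (D.map A r (extMap (p t) _ j) y)
    refine ⟨∑ t, LocalCohomology.map _ (q t) i (z t), ?_⟩
    simp_rw [map_sum, φ_map_apply, hz]
    exact hsum' y

end DeltaFunctor

/-! ### Exactness of `D` -/

section Dual

variable {A : Type u} [CommRing A] [IsLocalRing A] {r : ℕ}
  {X Y Z : Type u} [AddCommGroup X] [Module A X] [AddCommGroup Y] [Module A Y]
  [AddCommGroup Z] [Module A Z]

lemma D.map_injective {f : X →ₗ[A] Y} (hf : Function.Surjective f) :
    Function.Injective (D.map A r f) :=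
  fun _ _ h ↦ (LinearMap.cancel_right hf).mp h

lemma D.map_surjective (hI : Module.Injective A (DualizingModule A r)) {f : X →ₗ[A] Y}
    (hf : Function.Injective f) : Function.Surjective (D.map A r f) := fun y ↦ by
  obtain ⟨y', hy'⟩ := hI.out f hf y
  exact ⟨y', LinearMap.ext hy'⟩

lemma D.exists_map_eq (hI : Module.Injective A (DualizingModule A r)) {f : X →ₗ[A] Y}
    {g : Y →ₗ[A] Z} (hfg : ∀ y, g y = 0 → ∃ x, f x = y) (y : D A r Y) (hy : D.map A r f y = 0) :
    ∃ z, D.map A r g z = y := by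
  have hker : LinearMap.ker g ≤ LinearMap.ker y := fun b hb ↦ by
    obtain ⟨x, rfl⟩ := hfg b hb
    exact LinearMap.congr_fun hy x
  obtain ⟨z, hz⟩ := hI.out ((LinearMap.ker g).liftQ g le_rfl)
    (LinearMap.ker_eq_bot.mp (Submodule.ker_liftQ_eq_bot _ _ _ le_rfl))
    ((LinearMap.ker g).liftQ y hker)
  exact ⟨z, LinearMap.ext fun b ↦ hz (Submodule.Quotient.mk b)⟩

end Dual

/-! ### Bijectivity of `φ` -/

section Bijective

variable {A : Type u} [CommRing A] [IsRegularLocalRing A] {r : ℕ} (hr : ringKrullDim A = r)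

include hr

lemma subsingleton_localCohomology_of_lt (M : ModuleCat.{u} A) (i : ℕ) (hi : r < i) :
    Subsingleton (LocalCohomology (maximalIdeal A) M i) := by
  refine subsingleton_of_forall_eq 0 fun z ↦ ?_
  obtain ⟨k, -, α, rfl⟩ := exists_toLocalCohomology z 0
  have := hasProjectiveDimensionLT_of_isPowTorsion hr _ (isPowTorsion_quotPow (maximalIdeal A) k)
  rw [Ext.eq_zero_of_hasProjectiveDimensionLT α (r + 1) hi, map_zero]

lemma φ_self_bijective (i j : ℕ) (h : i + j = r) :
    Function.Bijective (φ (ModuleCat.of A A) i j h) := by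
  cases j with
  | zero =>
    obtain rfl : i = r := h
    -- Under `Ext^0(A, A) = A`, `φ z` is the map `a ↦ a • z`, with inverse evaluation at `1`.
    have hφ (z : LocalCohomology (maximalIdeal A) (.of A A) i) (f : (ModuleCat.of A A) ⟶ .of A A) :
        φ (ModuleCat.of A A) i 0 (add_zero i) z (Ext.mk₀ f) = f.hom 1 • z := by
      obtain ⟨k, -, α, rfl⟩ := exists_toLocalCohomology z 0
      have hf : f = f.hom 1 • 𝟙 _ := ModuleCat.hom_ext (LinearMap.ext_ring (by simp))
      rw [φ_toLocalCohomology]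
      conv_lhs => rw [hf, Ext.mk₀_smul, Ext.comp_smul, Ext.comp_mk₀_id, map_smul]
    refine ⟨(injective_iff_map_eq_zero _).mpr fun z hz ↦ ?_, fun y ↦ ⟨y (Ext.mk₀ (𝟙 _)), ?_⟩⟩
    · have := hφ z (𝟙 _)
      rw [hz] at this
      simpa using this.symm
    · ext β
      obtain ⟨f, rfl⟩ := (Ext.mk₀_bijective _ _).2 β
      have hf : f = f.hom 1 • 𝟙 _ := ModuleCat.hom_ext (LinearMap.ext_ring (by simp))
      rw [hφ, ← map_smul, ← Ext.mk₀_smul, ← hf]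
  | succ j =>
    have h₁ : Subsingleton (LocalCohomology (maximalIdeal A) (.of A A) i) := by
      refine subsingleton_of_forall_eq 0 fun z ↦ ?_
      obtain ⟨k, -, α, rfl⟩ := exists_toLocalCohomology z 0
      have := subsingleton_ext_of_isPowTorsion_of_lt hr _
        (isPowTorsion_quotPow (maximalIdeal A) k) i (by omega)
      rw [Subsingleton.elim α 0, map_zero]
    have h₂ : Subsingleton (Ext (ModuleCat.of A A) (.of A A) (j + 1)) :=
      Ext.subsingleton_of_projective _ _ j
    exact ⟨Function.injective_of_subsingleton _, Function.surjective_to_subsingleton _⟩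

lemma φ_pi_bijective (n : ℕ) (i j : ℕ) (h : i + j = r) :
    Function.Bijective (φ (ModuleCat.of A (Fin n → A)) i j h) := by
  refine φ_bijective_of_sum_eq_id (M := .of A A) (fun t ↦ ModuleCat.ofHom (LinearMap.proj t))
    (fun t ↦ ModuleCat.ofHom (LinearMap.single A (fun _ ↦ A) t)) ?_ i j h (φ_self_bijective hr i j h)
  refine ModuleCat.hom_ext (LinearMap.ext fun x ↦ ?_)
  rw [ModuleCat.hom_sum, LinearMap.sum_apply]
  exact Finset.univ_sum_single x

omit hr in
/-- A finitely generated module over a Noetherian ring has a presentation by a finite free one. -/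
lemma exists_shortExact (M : ModuleCat.{u} A) [Module.Finite A M] :
    ∃ (n : ℕ) (K : ModuleCat.{u} A) (_ : Module.Finite A K) (f : K ⟶ .of A (Fin n → A))
      (g : .of A (Fin n → A) ⟶ M) (w : f ≫ g = 0), (ShortComplex.mk f g w).ShortExact := by
  obtain ⟨n, g, hg⟩ := Module.Finite.exists_fin' A M
  exact ⟨n, .of A (LinearMap.ker g), inferInstanceAs (Module.Finite A (LinearMap.ker g)), _, _, _,
    LinearMap.shortExact_shortComplexKer hg⟩

/-- `Ext^0(M, A)` embeds in `Ext^0(F, A)` for `F` free onto `M`, so a functional on it extends and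
comes from `H^r(F)`. Applied also to `K`, this feeds the chase for injectivity. -/
lemma φ_surjective_top (M : ModuleCat.{u} A) [Module.Finite A M] :
    Function.Surjective (φ M r 0 (add_zero r)) := fun y ↦ by
  obtain ⟨n, K, _, f, g, w, hS⟩ := exists_shortExact M
  have hinj : Function.Injective (extMap g (.of A A) 0) := by
    have := hS.epi_g
    exact Ext.precomp_mk₀_injective_of_epi _ g
  obtain ⟨y', rfl⟩ := D.map_surjective (injective_dualizingModule hr) hinj y
  obtain ⟨z, rfl⟩ := (φ_pi_bijective hr n r 0 (add_zero r)).2 y'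
  exact ⟨LocalCohomology.map _ g r z, φ_map_apply _ _ _ _ _⟩

lemma φ_bijective_top (M : ModuleCat.{u} A) [Module.Finite A M] :
    Function.Bijective (φ M r 0 (add_zero r)) := by
  refine ⟨(injective_iff_map_eq_zero _).mpr fun z hz ↦ ?_, φ_surjective_top hr M⟩
  obtain ⟨n, K, _, f, g, w, hS⟩ := exists_shortExact M
  have := subsingleton_localCohomology_of_lt hr K (r + 1) r.lt_succ_self
  obtain ⟨z, rfl⟩ := LocalCohomology.exists_map_eq _ hS r z (Subsingleton.elim _ _)
  rw [φ_map_apply] at hz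
  obtain ⟨y, hy⟩ := D.exists_map_eq (injective_dualizingModule hr) (f := extMap g _ 0)
    (g := extMap f _ 0) (fun β hβ ↦ Ext.contravariant_sequence_exact₂ hS _ β hβ) _ hz
  obtain ⟨x, rfl⟩ := φ_surjective_top hr K y
  rw [← φ_map_apply] at hy
  exact ((LocalCohomology.exact_map_map _ hS r) z).mpr
    ⟨x, (φ_pi_bijective hr n r 0 (add_zero r)).1 hy⟩

/-- Local duality for regular local rings. -/
lemma φ_bijective (M : ModuleCat.{u} A) [Module.Finite A M] (i j : ℕ) (h : i + j = r) :
    Function.Bijective (φ M i j h) := by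
  induction j generalizing M i with
  | zero =>
    obtain rfl : i = r := h
    exact φ_bijective_top hr M
  | succ j ih =>
    obtain ⟨n, K, _, f, g, w, hS⟩ := exists_shortExact M
    have hK := ih K (i + 1) (by omega)
    have hF (j' : ℕ) : Subsingleton (Ext (ModuleCat.of A (Fin n → A)) (.of A A) (j' + 1)) :=
      Ext.subsingleton_of_projective _ _ _
    have hF' := (φ_pi_bijective hr n i (j + 1) h).1.subsingleton
    -- `Ext^j(K, A) → Ext^{j+1}(M, A)` is onto because `Ext^{j+1}(F, A) = 0`.
    have hδ : Function.Injective (D.map A r (extδ hS (.of A A) j)) :=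
      D.map_injective fun β ↦ Ext.contravariant_sequence_exact₃ hS _ β (Subsingleton.elim _ _)
        (add_comm 1 j)
    refine ⟨(injective_iff_map_eq_zero _).mpr fun z hz ↦ ?_, fun y ↦ ?_⟩
    · obtain ⟨x, rfl⟩ := LocalCohomology.exists_map_eq _ hS i z
        ((injective_iff_map_eq_zero _).mp hK.1 _ (by
          rw [φ_δ_apply hS i j (by omega) h, hz, map_zero]))
      rw [Subsingleton.elim x 0, map_zero]
    · obtain ⟨x, hx⟩ := hK.2 (D.map A r (extδ hS (.of A A) j) y)
      -- The image of `x` in `H^{i+1}(F)` is zero: `φ` is injective there, and consecutive maps in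
      -- the Ext sequence compose to zero.
      obtain ⟨z, rfl⟩ := LocalCohomology.exists_δ_eq _ hS i x
        ((φ_pi_bijective hr n (i + 1) j (by omega)).1 (by
          rw [φ_map_apply, hx, map_zero]
          ext β
          change y (hS.extClass.comp ((Ext.mk₀ f).comp β (zero_add j)) (add_comm 1 j)) = 0
          rw [hS.extClass_comp_assoc, map_zero]))
      exact ⟨z, hδ ((φ_δ_apply hS i j (by omega) h z).symm.trans hx)⟩

end Bijective

end LocalDuality

theorem mainTheorem5 {A : Type u} [CommRing A] [IsRegularLocalRing A] (r : ℕ)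
    (hr : ringKrullDim A = r) :
    -- `φ : H^i(M) → D(Ext^{r-i}(M, A))` is an isomorphism for every finitely generated `M`
    (∀ (M : ModuleCat.{u} A) [Module.Finite A M] (i j : ℕ) (h : i + j = r),
      Function.Bijective (LocalDuality.φ M i j h)) ∧
    -- in the degrees `i > r`, where `Ext^{r-i}(M, A)` is zero, so is `H^i(M)`
    (∀ (M : ModuleCat.{u} A) [Module.Finite A M] (i : ℕ), r < i →
      Subsingleton (LocalDuality.LocalCohomology (IsLocalRing.maximalIdeal A) M i)) ∧
    -- `φ` is functorial in `M`
    (∀ (M M' : ModuleCat.{u} A) (f : M ⟶ M') (i j : ℕ) (h : i + j = r),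
      LocalDuality.φ M' i j h ∘ₗ
          LocalDuality.LocalCohomology.map (IsLocalRing.maximalIdeal A) f i =
        LocalDuality.D.map A r (LocalDuality.extMap f (ModuleCat.of A A) j) ∘ₗ
          LocalDuality.φ M i j h) ∧
    -- `φ` commutes with the connecting homomorphisms
    (∀ (S : ShortComplex (ModuleCat.{u} A)) (hS : S.ShortExact) (i j : ℕ)
        (h : (i + 1) + j = r) (h' : i + (j + 1) = r),
      LocalDuality.φ S.X₁ (i + 1) j h ∘ₗ
          LocalDuality.LocalCohomology.δ (IsLocalRing.maximalIdeal A) hS i =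
        LocalDuality.D.map A r (LocalDuality.extδ hS (ModuleCat.of A A) j) ∘ₗ
          LocalDuality.φ S.X₃ i (j + 1) h') := by
  exact ⟨fun M _ i j h ↦ LocalDuality.φ_bijective hr M i j h,
    fun M _ i hi ↦ LocalDuality.subsingleton_localCohomology_of_lt hr M i hi,
    LocalDuality.φ_map, fun _ hS ↦ LocalDuality.φ_δ hS⟩
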